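/- Conventions. $S^1=\mathbb R/\mathbb Z$ with projection $\pi:\mathbb R\to S^1$, and all maps are continuous. For a map $f:\mathbb R\to X$, an $f$-sequence is a real sequence $(t_i)$ such that $(f(t_i))$ converges in $X$, and the group of exponents of $f$ is $$\mathcal E_f=\{\alpha\in\mathbb R : (\pi(\alpha t_i))_i \text{ converges in } S^1 \text{ for every } f\text{-sequence } (t_i)\},$$ a subgroup of $\mathbb R$. A $\kappa$-solenoid ($\kappa\le\infty$ countable; $\kappa=0$ gives a point) is the inverse limit $\Sigma_{\overline M}\subset\prod_{n\ge1}\mathbf T^\kappa$ of $\mathbf T^\kappa\xleftarrow{M_1}\mathbf T^\kappa\xleftarrow{M_2}\cdots$, $\mathbf T^\kappa=(S^1)^\kappa$, where each $M_n$ is a square integer matrix of non-zero determinant if $\kappa<\infty$, and is of the form (such a finite matrix)$\,\times\,\mathrm{id}$ if $\kappa=\infty$. Put $\pi_{\overline M}:\mathbb R^\kappa\to\Sigma_{\overline M}$, $\pi_{\overline M}(v)=(\pi^\kappa(v),\pi^\kappa(M_1^{-1}v),\pi^\kappa(M_2^{-1}M_1^{-1}v),\dots)$. For $\omega\in\mathbb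 R^\kappa$ the linear flow on $\Sigma_{\overline M}$ is $\Phi^\omega_{\overline M}(t,y)=\pi_{\overline M}(t\omega)+y$. Let $H=\{h_1=0,h_2,\dots\}$ be a countable subgroup of $\mathbb R$ (an enumeration, repetitions allowed), let $B=\{\omega_j\}_{j}$ be a maximal independent subset of $H$ of cardinality $\kappa$, enumerated without repetition, and put $H^1=\langle B\rangle_{\mathbb Z}$ and $H^n=\langle H^{n-1}\cup\{h_n\}\rangle_{\mathbb Z}$ for $n\ge2$. Choose $\mathbb Z$-bases $\{b^n_j\}_{j}$ of the $H^n$ with $b^1_j=\omega_j$ and, for each $n$, $b^{n+1}_j=b^n_j$ for all but finitely many $j$. The $B$-dual of $H$ for these choices is the $\kappa$-solenoid $\Sigma_{\overline M}$ whose matrices $M_n=(a^n_{rs})$ are given by $b^n_r=\sum_s a^n_{rs}b^{n+1}_s$. Theorem. Let $\phi$ be a flow (a continuous $\mathbb R$-action) on a metric space $X$, let $x\in X$ and $f=\phi_x$, $f(t)=\phi(t,x)$, and suppose that $\overline{f(\mathbb R)}$ is compact. Then $\mathcal E_f$ is countable. Let $\{h_1=0,h_2,\dots\}$ be any enumeration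 of $\mathcal E_f$ and let $B=\{\omega_j\}$ be any maximal independent subset of $\mathcal E_f$; put $\omega=(\omega_1,\omega_2,\dots)$. Then bases as above exist, and for every choice of them, with $\Sigma_{\overline M}$ the corresponding $B$-dual of $\mathcal E_f$: 1. There is a continuous surjection $h_f:\overline{f(\mathbb R)}\to\Sigma_{\overline M}$ such that $h_f(\phi(t,y))=\Phi^\omega_{\overline M}(t,h_f(y))$ for all $t\in\mathbb R$ and $y\in\overline{f(\mathbb R)}$; that is, $\mathrm{id}\times h_f$ is a semiconjugacy from $\phi|_{\mathbb R\times\overline{f(\mathbb R)}}$ onto $\Phi^\omega_{\overline M}$. 2. $\Phi^\omega_{\overline M}$ is maximal with respect to its exponent group: the exponent group of each of its orbits equals $\mathcal E_f$, and if $g:\overline{f(\mathbb R)}\to\Sigma_{\overline N}$ is a continuous surjection with $\mathrm{id}\times g$ a semiconjugacy from $\phi|_{\mathbb R\times\overline{f(\mathbb R)}}$ onto a linear flow $\Phi^{\omega'}_{\overline N}$ on a solenoid $\Sigma_{\overline N}$, then the exponent group of every orbit of $\Phi^{\omega'}_{\overline N}$ is contained in that of every orbit of $\Phi^\omega_{\overline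 M}$. -/

import Mathlib

open Set Filter Topology

noncomputable section

/-- The projection `π : ℝ → S¹ = ℝ/ℤ`. -/
def circleProj (t : ℝ) : UnitAddCircle := (t : UnitAddCircle)

/-- `t` is an `f`-sequence: the sequence `f (t i)` converges. -/
def IsExpSequence {X : Type*} [TopologicalSpace X] (f : ℝ → X) (t : ℕ → ℝ) : Prop :=
  ∃ y : X, Tendsto (fun i => f (t i)) atTop (𝓝 y)

/-- The group of exponents `ℰ_f` of a map `f : ℝ → X`: all real `α` such that `π (α tᵢ)` converges
in `S¹` for every `f`-sequence `tᵢ`. -/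
def expGroup {X : Type*} [TopologicalSpace X] (f : ℝ → X) : AddSubgroup ℝ where
  carrier := {α | ∀ t : ℕ → ℝ, IsExpSequence f t →
    ∃ z : UnitAddCircle, Tendsto (fun i => circleProj (α * t i)) atTop (𝓝 z)}
  zero_mem' := fun t _ => ⟨circleProj 0, by simp⟩
  add_mem' := by
    intro α β hα hβ t ht
    obtain ⟨z, hz⟩ := hα t ht
    obtain ⟨w, hw⟩ := hβ t ht
    refine ⟨z + w, ?_⟩
    simpa [circleProj, add_mul] using hz.add hw
  neg_mem' := by
    intro α hα t ht
    obtain ⟨z, hz⟩ := hα t ht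
    refine ⟨-z, ?_⟩
    simpa [circleProj, neg_mul] using hz.neg

/-- The closure of an orbit is invariant under the flow. -/
theorem isInvariant_closure_orbit {X : Type*} [TopologicalSpace X] (φ : Flow ℝ X) (x : X) :
    IsInvariant φ (closure (φ.orbit x)) := by
  intro t
  exact (φ.isInvariant_orbit x t).closure (φ.continuous_toFun t)

/-- The flow restricted to the closure of the orbit of `x`. -/
def orbitClosureFlow {X : Type*} [TopologicalSpace X] (φ : Flow ℝ X) (x : X) :
    Flow ℝ (closure (φ.orbit x)) :=
  φ.restrict (isInvariant_closure_orbit φ x)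

/-! ### Solenoids and their linear flows -/

/-- The action `y ↦ m y`, `(m y) r = ∑ s, m r s • y s`, of an integer matrix with finitely
supported rows on families `ι → A` in an abelian group `A`. -/
def rowAct {ι : Type*} (m : ι → ι →₀ ℤ) {A : Type*} [AddCommGroup A] (y : ι → A) : ι → A :=
  fun r => (m r).sum fun s a => a • y s

theorem rowAct_add {ι : Type*} (m : ι → ι →₀ ℤ) {A : Type*} [AddCommGroup A] (y z : ι → A) :
    rowAct m (y + z) = rowAct m y + rowAct m z := by
  funext r
  simp [rowAct, Finsupp.sum, Finset.sum_add_distrib]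

theorem rowAct_smul {ι : Type*} (m : ι → ι →₀ ℤ) (c : ℝ) (y : ι → ℝ) :
    rowAct m (c • y) = c • rowAct m y := by
  funext r
  simp only [rowAct, Finsupp.sum, Pi.smul_apply, smul_eq_mul, Finset.mul_sum, zsmul_eq_mul]
  exact Finset.sum_congr rfl fun s _ => by ring

theorem circleProj_rowAct {ι : Type*} (m : ι → ι →₀ ℤ) (y : ι → ℝ) (r : ι) :
    circleProj (rowAct m y r) = rowAct m (fun s => circleProj (y s)) r := by
  have := map_sum (QuotientAddGroup.mk' (AddSubgroup.zmultiples (1 : ℝ)))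
    (fun s => m r s • y s) (m r).support
  simp only [map_zsmul] at this
  exact this

open scoped Classical in
/-- The square block of `m` on the finite index set `S`. -/
def rowBlock {ι : Type*} (m : ι → ι →₀ ℤ) (S : Finset ι) : Matrix S S ℤ :=
  Matrix.of fun r s => m r s

open scoped Classical in
/-- `m` has the form `M × id` with `M` a square integer matrix of non-zero determinant, indexed by a
finite set `S`. If `ι` is finite this says exactly that `m` has non-zero determinant. -/
def IsBlockInvertible {ι : Type*} (m : ι → ι →₀ ℤ) : Prop :=
  ∃ S : Finset ι, (∀ r ∉ S, m r = Finsupp.single r 1) ∧ (∀ r ∈ S, (m r).support ⊆ S) ∧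
    (rowBlock m S).det ≠ 0

/-- On real vectors such a matrix acts bijectively. -/
theorem IsBlockInvertible.bijective {ι : Type*} {m : ι → ι →₀ ℤ} (hm : IsBlockInvertible m) :
    Function.Bijective (rowAct m : (ι → ℝ) → ι → ℝ) := by
  classical
  obtain ⟨S, h1, h2, h3⟩ := hm
  set N : Matrix S S ℝ := (rowBlock m S).map (Int.cast : ℤ → ℝ) with hN
  have hdet : N.det ≠ 0 := by
    have : N.det = (((rowBlock m S).det : ℤ) : ℝ) := by
      rw [hN, Int.cast_det]
    rw [this]
    have h3' : (rowBlock m S).det ≠ 0 := by convert h3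
    exact Int.cast_ne_zero.mpr h3'
  have hunit : IsUnit N.det := isUnit_iff_ne_zero.mpr hdet
  have hout : ∀ (x : ι → ℝ) (r : ι), r ∉ S → rowAct m x r = x r := by
    intro x r hr
    simp [rowAct, h1 r hr]
  have hin : ∀ (x : ι → ℝ) (r : S), rowAct m x r = N.mulVec (fun s : S => x s) r := by
    intro x r
    rw [rowAct, Finsupp.sum_of_support_subset _ (h2 r r.2) _ (by simp), ← Finset.sum_coe_sort]
    simp [Matrix.mulVec, dotProduct, hN, rowBlock]
  constructor
  · intro x y hxy
    have hS : (fun s : S => x s) = fun s : S => y s := by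
      apply Matrix.mulVec_injective_of_isUnit ((Matrix.isUnit_iff_isUnit_det N).mpr hunit)
      funext r
      rw [← hin, ← hin, hxy]
    funext r
    by_cases hr : r ∈ S
    · exact congrFun hS ⟨r, hr⟩
    · rw [← hout x r hr, ← hout y r hr, hxy]
  · intro y
    let u : S → ℝ := N⁻¹.mulVec fun s : S => y s
    let x : ι → ℝ := fun r => if hr : r ∈ S then u ⟨r, hr⟩ else y r
    refine ⟨x, ?_⟩
    funext r
    by_cases hr : r ∈ S
    · have hx : (fun s : S => x s) = u := by
        funext s
        simp [x]
      have := hin x ⟨r, hr⟩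
      rw [hx] at this
      simp only [u, Matrix.mulVec_mulVec, Matrix.mul_nonsing_inv N hunit, Matrix.one_mulVec] at this
      exact this
    · rw [hout x r hr]
      simp [x, hr]

/-- The sequence `M̄ = (M₁, M₂, …)` of matrices (indexed from `0`) defining a `κ`-solenoid, where
`κ` is the cardinality of `ι`. -/
structure SolenoidMatrices (ι : Type*) where
  mat : ℕ → ι → ι →₀ ℤ
  block : ∀ n, IsBlockInvertible (mat n)

namespace SolenoidMatrices

variable {ι : Type*} (M : SolenoidMatrices ι)

/-- The solenoid `Σ_M̄`: the inverse limit of `𝐓^κ ← 𝐓^κ ← ⋯` with bonding maps `M₁, M₂, …`, as a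
topological subgroup of `∏ 𝐓^κ`. -/
def solenoid : AddSubgroup (ℕ → ι → UnitAddCircle) where
  carrier := {y | ∀ n, rowAct (M.mat n) (y (n + 1)) = y n}
  zero_mem' := by
    intro n
    funext r
    simp [rowAct]
  add_mem' := by
    intro y z hy hz n
    rw [Pi.add_apply, rowAct_add, hy n, hz n, Pi.add_apply]
  neg_mem' := by
    intro y hy n
    rw [Pi.neg_apply, Pi.neg_apply, ← hy n]
    funext r
    simp [rowAct, Finsupp.sum]

/-- The sequence `(x, M₁⁻¹ x, M₂⁻¹ M₁⁻¹ x, …)`. -/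
def realLift (x : ι → ℝ) : ℕ → ι → ℝ
  | 0 => x
  | n + 1 => (Equiv.ofBijective _ (M.block n).bijective).symm (realLift x n)

theorem rowAct_realLift (x : ι → ℝ) (n : ℕ) :
    rowAct (M.mat n) (M.realLift x (n + 1)) = M.realLift x n :=
  (Equiv.ofBijective _ (M.block n).bijective).apply_symm_apply _

theorem realLift_add (x y : ι → ℝ) (n : ℕ) :
    M.realLift (x + y) n = M.realLift x n + M.realLift y n := by
  induction n with
  | zero => rfl
  | succ n ih =>
    apply (M.block n).bijective.1
    rw [rowAct_add]
    simp only [rowAct_realLift, ih]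

theorem realLift_smul (c : ℝ) (x : ι → ℝ) (n : ℕ) :
    M.realLift (c • x) n = c • M.realLift x n := by
  induction n with
  | zero => rfl
  | succ n ih =>
    apply (M.block n).bijective.1
    rw [rowAct_smul]
    simp only [rowAct_realLift, ih]

/-- The homomorphism `π_M̄ : ℝ^κ → Σ_M̄`,
`π_M̄ x = (π^κ x, π^κ (M₁⁻¹ x), π^κ (M₂⁻¹ M₁⁻¹ x), …)`. -/
def proj (x : ι → ℝ) : M.solenoid :=
  ⟨fun n r => circleProj (M.realLift x n r), fun n => by
    funext r
    rw [← circleProj_rowAct, rowAct_realLift]⟩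

theorem proj_add (x y : ι → ℝ) : M.proj (x + y) = M.proj x + M.proj y := by
  apply Subtype.ext
  funext n r
  simp [proj, realLift_add, circleProj]

theorem continuous_proj_smul (ω : ι → ℝ) : Continuous fun t : ℝ => M.proj (t • ω) := by
  refine Continuous.subtype_mk (continuous_pi fun n => continuous_pi fun r => ?_) _
  simp only [realLift_smul]
  exact (AddCircle.continuous_mk' (1 : ℝ)).comp (continuous_id.mul continuous_const)

/-- The linear flow `Φ^ω_M̄ (t, x) = π_M̄ (t ω) + x` on `Σ_M̄`. -/
def linearFlow (ω : ι → ℝ) : Flow ℝ M.solenoid where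
  toFun t x := M.proj (t • ω) + x
  cont' := ((M.continuous_proj_smul ω).comp continuous_fst).add continuous_snd
  map_add' s t x := by
    rw [add_smul, proj_add, add_assoc]
  map_zero' x := by
    have h : M.proj ((0 : ℝ) • ω) = 0 := by
      have h := M.proj_add ((0 : ℝ) • ω) ((0 : ℝ) • ω)
      rw [← add_smul, add_zero] at h
      exact left_eq_add.mp h
    rw [h, zero_add]

end SolenoidMatrices

/-! ### The `B`-dual of a countable subgroup of the reals -/

/-- The family `ω` enumerates, without repetition, a maximal independent subset `B` of `H`. -/
structure IsMaximalIndependent {ι : Type*} (H : AddSubgroup ℝ) (ω : ι → ℝ) : Prop where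
  mem : ∀ j, ω j ∈ H
  indep : LinearIndependent ℤ ω
  maximal : ∀ s : Set ℝ, range ω ⊆ s → s ⊆ H →
    LinearIndependent ℤ (fun a : s => (a : ℝ)) → s = range ω

/-- The groups `H¹ ⊆ H² ⊆ ⋯` (indexed from `0`) of the `B`-sequence of `H = {h 0 = 0, h 1, …}` with
`B = range ω`. -/
def bSeq {ι : Type*} (ω : ι → ℝ) (h : ℕ → ℝ) : ℕ → AddSubgroup ℝ
  | 0 => AddSubgroup.closure (range ω)
  | n + 1 => AddSubgroup.closure ((bSeq ω h n : Set ℝ) ∪ {h (n + 1)})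

theorem bSeq_le_succ {ι : Type*} (ω : ι → ℝ) (h : ℕ → ℝ) (n : ℕ) :
    bSeq ω h n ≤ bSeq ω h (n + 1) :=
  fun _ hx => AddSubgroup.subset_closure (Or.inl hx)

/-- A choice of bases of the groups of the `B`-sequence, the first of which is `B` itself and each
of which differs from its successor in finitely many members only, so that the inclusions are
represented by (transposed) matrices of the form `M × id`. -/
structure BSeqBases {ι : Type*} (ω : ι → ℝ) (h : ℕ → ℝ) where
  basis : ∀ n, Module.Basis ι ℤ (bSeq ω h n)
  basis_zero : ∀ j, (basis 0 j : ℝ) = ω j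
  finite_ne : ∀ n, {j | (basis (n + 1) j : ℝ) ≠ basis n j}.Finite

namespace BSeqBases

variable {ι : Type*} {ω : ι → ℝ} {h : ℕ → ℝ} (b : BSeqBases ω h)

/-- The integers `a_{rs}` with `b^n_r = ∑ s, a_{rs} b^{n+1}_s`. -/
def coord (n : ℕ) (r : ι) : ι →₀ ℤ :=
  (b.basis (n + 1)).repr (AddSubgroup.inclusion (bSeq_le_succ ω h n) (b.basis n r))

theorem coord_sum (n : ℕ) (r : ι) :
    ((b.coord n r).sum fun s a => a • (b.basis (n + 1) s : ℝ)) = b.basis n r := by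
  have h1 := (b.basis (n + 1)).linearCombination_repr
    (AddSubgroup.inclusion (bSeq_le_succ ω h n) (b.basis n r))
  have h2 := congrArg (fun z : bSeq ω h (n + 1) => (z : ℝ)) h1
  simpa [Finsupp.linearCombination_apply, Finsupp.sum, coord] using h2

theorem coord_block (n : ℕ) : IsBlockInvertible (b.coord n) := by
  classical
  set T := (b.finite_ne n).toFinset with hT
  have hsingle : ∀ r ∉ T, b.coord n r = Finsupp.single r 1 := by
    intro r hr
    have hr' : (b.basis (n + 1) r : ℝ) = b.basis n r := by
      simpa [hT] using hr
    have : AddSubgroup.inclusion (bSeq_le_succ ω h n) (b.basis n r) = b.basis (n + 1) r :=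
      Subtype.ext hr'.symm
    rw [coord, this, Module.Basis.repr_self]
  set S := T ∪ T.biUnion fun r => (b.coord n r).support with hS
  have hsup : ∀ r ∈ S, (b.coord n r).support ⊆ S := by
    intro r hr
    by_cases hrT : r ∈ T
    · intro s hs
      exact Finset.mem_union_right _ (Finset.mem_biUnion.mpr ⟨r, hrT, hs⟩)
    · rw [hsingle r hrT]
      exact Finsupp.support_single_subset.trans (Finset.singleton_subset_iff.mpr hr)
  refine ⟨S, fun r hr => hsingle r fun hrT => hr (Finset.mem_union_left _ hrT), hsup, ?_⟩
  intro hdet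
  have hdet' : (rowBlock (b.coord n) S).det = 0 := by convert hdet
  obtain ⟨v, hv0, hv⟩ := Matrix.exists_vecMul_eq_zero_iff.mpr hdet'
  have hind : LinearIndependent ℤ fun r : S => b.basis n r :=
    (b.basis n).linearIndependent.comp _ Subtype.val_injective
  apply hv0
  funext r
  refine Fintype.linearIndependent_iff.mp hind v ?_ r
  apply Subtype.ext
  have hrow : ∀ r : S, (b.basis n r : ℝ) = ∑ s : S, b.coord n r s • (b.basis (n + 1) s : ℝ) := by
    intro r
    rw [← b.coord_sum n r, Finsupp.sum_of_support_subset _ (hsup r r.2) _ (by simp),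
      ← Finset.sum_coe_sort]
  have hcol : ∀ s : S, ∑ r : S, v r * b.coord n r s = 0 := by
    intro s
    simpa [Matrix.vecMul, dotProduct, rowBlock] using congrFun hv s
  simp only [AddSubgroup.val_finsetSum, AddSubgroup.coe_zsmul, ZeroMemClass.coe_zero]
  calc ∑ r : S, v r • (b.basis n r : ℝ)
      = ∑ r : S, ∑ s : S, (v r * b.coord n r s) • (b.basis (n + 1) s : ℝ) := by
        refine Finset.sum_congr rfl fun r _ => ?_
        rw [hrow r, Finset.smul_sum]
        exact Finset.sum_congr rfl fun s _ => by rw [mul_smul]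
    _ = ∑ s : S, (∑ r : S, v r * b.coord n r s) • (b.basis (n + 1) s : ℝ) := by
        rw [Finset.sum_comm]
        exact Finset.sum_congr rfl fun s _ => by rw [Finset.sum_smul]
    _ = 0 := Finset.sum_eq_zero fun s _ => by rw [hcol s, zero_smul]

/-- The matrices of the `B`-dual: the bonding maps of `Σ_M̄` are the transposes of the inclusions of
the `B`-sequence, written in the chosen bases. -/
def dual : SolenoidMatrices ι where
  mat := b.coord
  block := b.coord_block

end BSeqBases

end

/-! Let K be the orbit closure. For an exponent α, the function t ↦ π(αt) extends from the dense
orbit to a continuous map χ_α : K → S¹ (`exists_character_of_mem_expGroup`). Distinct exponents give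
maps at uniform distance at least 1/2, and C(K, S¹) is separable, so there are only countably many
exponents. By maximality of B every exponent has a nonzero integer multiple in ⟨B⟩; hence passing
from Hⁿ to Hⁿ⁺¹ disturbs only a finite part of a basis, and suitable bases exist.

The matrices of the dual express bⁿ in terms of bⁿ⁺¹, so the real lift of ω at level n is bⁿ itself
and the coordinates of π_M(tω) are π(t bⁿ_r). The maps χ attached to the bⁿ_r therefore assemble
into a map from K to the solenoid: the bonding relations and equivariance hold on the orbit and
extend by density. It is onto because its image is compact and, by Kronecker's theorem
(`denseRange_circleProj_mul`), meets every condition on finitely many coordinates.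

A semiconjugacy carries convergent orbit sequences to convergent ones, so the exponents of any
factor lie in ℰ_f (`expGroup_proj_le_of_isSemiconjugacy`). For the dual the reverse inclusion holds
too, since each exponent lies in some Hⁿ and the bⁿ_r are read off from coordinates. Maximality
follows. -/

/-! ### Kronecker's theorem by time averages -/

theorem tendsto_average_exp_mul_I {a : ℝ} (ha : a ≠ 0) :
    Tendsto (fun T : ℝ => (T⁻¹ : ℂ) * ∫ t in (0 : ℝ)..T, Complex.exp (a * Complex.I * t)) atTop
      (𝓝 0) := by
  have hc : (a * Complex.I : ℂ) ≠ 0 := by simp [ha]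
  have hbound : Tendsto (fun T : ℝ => T⁻¹ * (2 / |a|)) atTop (𝓝 0) := by
    simpa using tendsto_inv_atTop_zero.mul_const (2 / |a|)
  refine squeeze_zero_norm' ?_ hbound
  filter_upwards [eventually_gt_atTop 0] with T hT
  rw [integral_exp_mul_complex hc, norm_mul, norm_inv, Complex.norm_real, Real.norm_of_nonneg hT.le]
  refine mul_le_mul_of_nonneg_left ?_ (inv_nonneg.mpr hT.le)
  rw [norm_div, norm_mul, Complex.norm_I, mul_one, Complex.norm_real, Real.norm_eq_abs]
  refine div_le_div_of_nonneg_right ((norm_sub_le _ _).trans (le_of_eq ?_)) (abs_nonneg _)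
  have h1 : (a * Complex.I * T : ℂ) = ((a * T : ℝ) : ℂ) * Complex.I := by push_cast; ring
  rw [h1, Complex.norm_exp_ofReal_mul_I]
  simp
  norm_num

open UnitAddTorus in
theorem mFourier_add_circleProj_mul {d : Type*} [Fintype d] (n : d → ℤ) (w : d → ℝ)
    (z : d → UnitAddCircle) (t : ℝ) :
    mFourier n (z + fun j => circleProj (t * w j)) =
      mFourier n z * Complex.exp ((2 * Real.pi * ∑ j, n j * w j : ℝ) * Complex.I * t) := by
  simp only [mFourier, ContinuousMap.coe_mk, Pi.add_apply]
  rw [Complex.ofReal_mul, Complex.ofReal_sum, Finset.mul_sum, Finset.sum_mul, Finset.sum_mul,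
    Complex.exp_sum, ← Finset.prod_mul_distrib]
  refine Finset.prod_congr rfl fun j _ => ?_
  rw [fourier_apply, smul_add, AddCircle.toCircle_add, Circle.coe_mul, ← fourier_apply,
    ← fourier_apply, circleProj, fourier_coe_apply]
  congr 2
  push_cast
  ring

open UnitAddTorus in
/-- Along a linear flow with rationally independent frequencies, the time averages of a
trigonometric polynomial converge to a limit that does not depend on the initial point. -/
theorem exists_tendsto_average_of_mem_span_mFourier {d : Type*} [Fintype d] {w : d → ℝ}
    (hw : LinearIndependent ℤ w) {P : C(UnitAddTorus d, ℂ)}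
    (hP : P ∈ Submodule.span ℂ (range (mFourier (d := d)))) :
    ∃ c : ℂ, ∀ z : d → UnitAddCircle, Tendsto
      (fun T : ℝ => (T⁻¹ : ℂ) * ∫ t in (0 : ℝ)..T, P (z + fun j => circleProj (t * w j)))
      atTop (𝓝 c) := by
  have hcont : ∀ (Q : C(UnitAddTorus d, ℂ)) (z : d → UnitAddCircle) (a b : ℝ),
      IntervalIntegrable (fun t : ℝ => Q (z + fun j => circleProj (t * w j)))
        MeasureTheory.volume a b := by
    intro Q z a b
    refine Continuous.intervalIntegrable (Q.continuous.comp (continuous_const.add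
      (continuous_pi fun j => ?_))) _ _
    exact (AddCircle.continuous_mk' (1 : ℝ)).comp (continuous_id.mul continuous_const)
  induction hP using Submodule.span_induction with
  | mem P hP =>
    obtain ⟨n, rfl⟩ := hP
    by_cases hn : n = 0
    · subst hn
      refine ⟨1, fun z => tendsto_const_nhds.congr' ?_⟩
      filter_upwards [eventually_gt_atTop 0] with T hT
      simp [mFourier_zero, hT.ne']
    · have ha : (2 * Real.pi * ∑ j, n j * w j : ℝ) ≠ 0 := by
        refine mul_ne_zero (by positivity) fun h0 => hn ?_
        funext j
        exact Fintype.linearIndependent_iff.mp hw n (by simpa using h0) j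
      refine ⟨0, fun z => ?_⟩
      simp only [mFourier_add_circleProj_mul, intervalIntegral.integral_const_mul]
      simpa [mul_left_comm] using (tendsto_average_exp_mul_I ha).const_mul (mFourier n z)
  | zero => exact ⟨0, fun z => by simp⟩
  | add P Q _ _ hP hQ =>
    obtain ⟨c, hc⟩ := hP
    obtain ⟨e, he⟩ := hQ
    refine ⟨c + e, fun z => ((hc z).add (he z)).congr fun T => ?_⟩
    simp only [ContinuousMap.add_apply]
    rw [intervalIntegral.integral_add (hcont P z _ _) (hcont Q z _ _), mul_add]
  | smul a P _ hP =>
    obtain ⟨c, hc⟩ := hP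
    refine ⟨a * c, fun z => ((hc z).const_mul a).congr fun T => ?_⟩
    simp only [ContinuousMap.smul_apply, smul_eq_mul, intervalIntegral.integral_const_mul]
    ring

/-- Kronecker's theorem: a linear flow with rationally independent frequencies on a torus has a
dense orbit. -/
theorem denseRange_circleProj_mul {d : Type*} [Fintype d] {w : d → ℝ}
    (hw : LinearIndependent ℤ w) :
    DenseRange fun (t : ℝ) (j : d) => circleProj (t * w j) := by
  set F : ℝ → d → UnitAddCircle := fun t j => circleProj (t * w j) with hF
  have hFadd : ∀ s t, F (s + t) = F s + F t := by
    intro s t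
    funext j
    simp [hF, circleProj, add_mul]
  let A : AddSubgroup (d → UnitAddCircle) := (AddMonoidHom.mk' F hFadd).range.topologicalClosure
  have hA : IsClosed (A : Set (d → UnitAddCircle)) := AddSubgroup.isClosed_topologicalClosure _
  have hFA : ∀ t, F t ∈ A := fun t => AddSubgroup.le_topologicalClosure _ ⟨t, rfl⟩
  suffices h : ∀ y, y ∈ A from h
  by_contra! hy
  obtain ⟨y, hy⟩ := hy
  -- A and its coset y + A are disjoint, closed and invariant under the flow. A function equal to 0
  -- on one and 1 on the other has time averages 0 and 1, while an approximating trigonometric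
  -- polynomial has the same average c on both; an error of 1/3 already makes this impossible.
  have hdisj : Disjoint (A : Set (d → UnitAddCircle)) ((fun z => -y + z) ⁻¹' A) := by
    rw [Set.disjoint_left]
    intro z hz hz'
    apply hy
    have := A.sub_mem hz hz'
    simpa using this
  obtain ⟨f, hf0, hf1, -⟩ := exists_continuous_zero_one_of_isClosed hA
    (hA.preimage (continuous_const.add continuous_id)) hdisj
  let G : C(UnitAddTorus d, ℂ) := ⟨fun z => (f z : ℂ), by fun_prop⟩
  have hG : G ∈ closure (Submodule.span ℂ (range (UnitAddTorus.mFourier (d := d))) :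
      Set C(UnitAddTorus d, ℂ)) := by
    have h : G ∈ (Submodule.span ℂ
        (range (UnitAddTorus.mFourier (d := d)))).topologicalClosure := by
      rw [UnitAddTorus.span_mFourier_closure_eq_top]
      trivial
    exact h
  obtain ⟨P, hP, hPG⟩ := Metric.mem_closure_iff.mp hG (1 / 3) (by norm_num)
  obtain ⟨c, hc⟩ := exists_tendsto_average_of_mem_span_mFourier hw hP
  have key : ∀ (z : d → UnitAddCircle) (v : ℂ), (∀ t, G (z + F t) = v) → ‖c - v‖ ≤ 1 / 3 := by
    intro z v hv
    refine le_of_tendsto ((hc z).sub_const v).norm ?_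
    filter_upwards [eventually_gt_atTop 0] with T hT
    have hint : IntervalIntegrable (fun t : ℝ => P (z + F t)) MeasureTheory.volume 0 T := by
      refine Continuous.intervalIntegrable (P.continuous.comp (continuous_const.add
        (continuous_pi fun j => ?_))) _ _
      exact (AddCircle.continuous_mk' (1 : ℝ)).comp (continuous_id.mul continuous_const)
    have h1 : (T⁻¹ : ℂ) * (∫ t in (0 : ℝ)..T, P (z + F t)) - v =
        (T⁻¹ : ℂ) * ∫ t in (0 : ℝ)..T, (P (z + F t) - v) := by
      rw [intervalIntegral.integral_sub hint (by simp), intervalIntegral.integral_const]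
      have hT' : (T : ℂ) ≠ 0 := by exact_mod_cast hT.ne'
      simp only [sub_zero, Complex.real_smul]
      field_simp
    have h2 : ‖∫ t in (0 : ℝ)..T, (P (z + F t) - v)‖ ≤ 1 / 3 * |T - 0| := by
      refine intervalIntegral.norm_integral_le_of_norm_le_const fun t _ => ?_
      rw [← hv t, ← dist_eq_norm, dist_comm]
      exact (ContinuousMap.dist_apply_le_dist _).trans hPG.le
    rw [h1, norm_mul, norm_inv, Complex.norm_real, Real.norm_of_nonneg hT.le]
    rw [sub_zero, abs_of_pos hT] at h2
    calc T⁻¹ * _ ≤ T⁻¹ * (1 / 3 * T) := mul_le_mul_of_nonneg_left h2 (inv_nonneg.mpr hT.le)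
      _ = 1 / 3 := by field_simp
  have k0 := key 0 0 fun t => by
    have : f (0 + F t) = 0 := hf0 (by simpa using hFA t)
    simpa [G] using this
  have k1 := key y 1 fun t => by
    have : f (y + F t) = 1 := hf1 (by simpa using hFA t)
    simp [G, this]
  have : ‖(1 : ℂ)‖ ≤ ‖c - 0‖ + ‖c - 1‖ := by
    calc ‖(1 : ℂ)‖ = ‖(c - 0) - (c - 1)‖ := by ring_nf
      _ ≤ _ := norm_sub_le _ _
  rw [norm_one] at this
  linarith

/-! ### Characters on the orbit closure and countability -/

/-- The extension is the pointwise limit. Regularity of the target gives continuity: a closed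
neighbourhood that contains the values of `F` near `y` also contains the limits at all nearby
points. -/
theorem exists_continuous_extension {T X Y : Type*} [TopologicalSpace X] [TopologicalSpace Y]
    [T3Space Y] {f : T → X} {F : T → Y} (hf : DenseRange f)
    (h : ∀ y, ∃ z, Tendsto F (comap f (𝓝 y)) (𝓝 z)) :
    ∃ g : C(X, Y), ∀ t, g (f t) = F t := by
  choose g hg using h
  refine ⟨⟨g, ?_⟩, fun t => ?_⟩
  · rw [continuous_iff_continuousAt]
    intro y
    refine ((closed_nhds_basis (g y)).tendsto_right_iff).mpr fun V ⟨hV, hVc⟩ => ?_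
    obtain ⟨U, hU, hUV⟩ := mem_comap.mp (hg y hV)
    filter_upwards [eventually_mem_nhds_iff.mpr hU] with y' hy'
    have hbot : (comap f (𝓝 y')).NeBot := 
      comap_neBot_iff_frequently.mpr (mem_closure_iff_frequently.mp (hf y'))
    exact hVc.mem_of_tendsto (hg y') (mem_of_superset (preimage_mem_comap hy') hUV)
  · have hle : pure t ≤ comap f (𝓝 (f t)) := tendsto_iff_comap.mp (tendsto_pure_nhds f t)
    exact tendsto_nhds_unique ((hg (f t)).mono_left hle) (tendsto_pure_nhds F t)

/-- The definition of an exponent allows the limit to depend on the sequence. Interleaving two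
sequences with the same limit point shows that it does not, and first countability turns this into a
filter limit. -/
theorem exists_tendsto_circleProj_of_mem_expGroup {X : Type*} [TopologicalSpace X]
    [FirstCountableTopology X] {f : ℝ → X} {α : ℝ} (hα : α ∈ expGroup f) {y : X}
    (hy : y ∈ closure (range f)) :
    ∃ z, Tendsto (fun t => circleProj (α * t)) (comap f (𝓝 y)) (𝓝 z) := by
  have hbot : (comap f (𝓝 y)).NeBot := 
    comap_neBot_iff_frequently.mpr (mem_closure_iff_frequently.mp hy)
  obtain ⟨s, hs⟩ := exists_seq_tendsto (comap f (𝓝 y))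
  obtain ⟨z, hz⟩ := hα s ⟨y, tendsto_comap_iff.mp hs⟩
  refine ⟨z, tendsto_of_seq_tendsto fun u hu => ?_⟩
  obtain ⟨w, hw⟩ := hα u ⟨y, tendsto_comap_iff.mp hu⟩
  let v : ℕ → ℝ := fun i => if Even i then s (i / 2) else u (i / 2)
  have hdiv : Tendsto (fun i : ℕ => i / 2) atTop atTop := Nat.tendsto_div_const_atTop two_ne_zero
  have hv : Tendsto v atTop (comap f (𝓝 y)) := (hs.comp hdiv).if' (hu.comp hdiv)
  obtain ⟨a, ha⟩ := hα v ⟨y, tendsto_comap_iff.mp hv⟩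
  have h1 : a = z := by
    refine tendsto_nhds_unique (ha.comp (f := fun i : ℕ => 2 * i) ?_) (hz.congr fun i => ?_)
    · exact tendsto_atTop_mono (fun i => by simp only [id]; omega) tendsto_id
    · simp [v]
  have h2 : a = w := by
    refine tendsto_nhds_unique (ha.comp (f := fun i : ℕ => 2 * i + 1) ?_) (hw.congr fun i => ?_)
    · exact tendsto_atTop_mono (fun i => by simp only [id]; omega) tendsto_id
    · have : (2 * i + 1) / 2 = i := by omega
      simp [v, this]
  rwa [← h1, h2]

/-- The orbit map, with values in the closure of the orbit. -/
def orbitPoint {X : Type*} [TopologicalSpace X] (φ : Flow ℝ X) (x : X) (t : ℝ) :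
    closure (φ.orbit x) :=
  ⟨φ t x, subset_closure (φ.mem_orbit x t)⟩

theorem denseRange_orbitPoint {X : Type*} [TopologicalSpace X] (φ : Flow ℝ X) (x : X) :
    DenseRange (orbitPoint φ x) := by
  rintro ⟨y, hy⟩
  rw [closure_subtype, ← range_comp]
  exact hy

/-- Every exponent of an orbit defines a continuous character on the closure of the orbit. -/
theorem exists_character_of_mem_expGroup {X : Type*} [MetricSpace X] (φ : Flow ℝ X) (x : X)
    {α : ℝ} (hα : α ∈ expGroup fun t => φ t x) :
    ∃ χ : C(closure (φ.orbit x), UnitAddCircle), ∀ t, χ (orbitPoint φ x t) = circleProj (α * t) := by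
  refine exists_continuous_extension (denseRange_orbitPoint φ x) fun y => ?_
  rw [nhds_subtype, comap_comap]
  exact exists_tendsto_circleProj_of_mem_expGroup hα y.2

theorem countable_expGroup {X : Type*} [MetricSpace X] (φ : Flow ℝ X) (x : X)
    (hcompact : IsCompact (closure (φ.orbit x))) :
    (expGroup fun t => φ t x : Set ℝ).Countable := by
  have : CompactSpace (closure (φ.orbit x)) := isCompact_iff_compactSpace.mp hcompact
  choose! χ hχ using fun α (hα : α ∈ expGroup fun t => φ t x) =>
    exists_character_of_mem_expGroup φ x hα
  refine Set.PairwiseDisjoint.countable_of_isOpen (s := fun α => Metric.ball (χ α) (1 / 4)) ?_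
    (fun _ _ => Metric.isOpen_ball) fun α _ => ⟨χ α, Metric.mem_ball_self (by norm_num)⟩
  intro α hα β hβ hne
  refine Metric.ball_disjoint_ball ?_
  refine le_trans (le_of_eq ?_)
    -- At this time the phases αt and βt differ by exactly half a turn, so the centres are at
    -- distance at least 1/2 = 1/4 + 1/4.
    (ContinuousMap.dist_apply_le_dist (orbitPoint φ x (1 / (2 * (α - β)))))
  have hne' : α - β ≠ 0 := sub_ne_zero.mpr hne
  have hhalf : α * (1 / (2 * (α - β))) - β * (1 / (2 * (α - β))) = 1 / 2 := by
    field_simp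
  rw [hχ α hα, hχ β hβ, dist_eq_norm, circleProj, circleProj, ← AddCircle.coe_sub, hhalf,
    AddCircle.norm_half_period_eq]
  norm_num

/-! ### Existence of bases for the `B`-sequence -/

theorem exists_basis_of_closure_range_eq {ι A : Type*} [AddCommGroup A] {C : AddSubgroup A}
    {v : ι → A} (hv : LinearIndependent ℤ v) (hC : AddSubgroup.closure (range v) = C) :
    ∃ b : Module.Basis ι ℤ C, ∀ j, (b j : A) = v j := by
  subst hC
  have hmem : ∀ x : A, x ∈ Submodule.span ℤ (range v) ↔ x ∈ AddSubgroup.closure (range v) := by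
    intro x
    rw [← Submodule.span_int_eq_addSubgroupClosure]
    rfl
  let e : Submodule.span ℤ (range v) ≃+ AddSubgroup.closure (range v) :=
    { toFun := fun x => ⟨x, (hmem x).mp x.2⟩
      invFun := fun x => ⟨x, (hmem x).mpr x.2⟩
      left_inv := fun _ => rfl
      right_inv := fun _ => rfl
      map_add' := fun _ _ => rfl }
  refine ⟨(Module.Basis.span hv).map e.toIntLinearEquiv, fun j => ?_⟩
  exact congrArg Subtype.val (Module.Basis.span_apply hv j)

/-- Multiplication by `k` embeds the larger span into the smaller one, because ℝ is torsion-free; so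
the ranks agree. -/
theorem finrank_span_insert_eq_card {ι : Type*} [Fintype ι] {u : ι → ℝ}
    (hu : LinearIndependent ℤ u) {h : ℝ} {k : ℤ} (hk : k ≠ 0)
    (hkh : k • h ∈ Submodule.span ℤ (range u)) :
    Module.finrank ℤ (Submodule.span ℤ (insert h (range u))) = Fintype.card ι := by
  have hmem : ∀ x ∈ Submodule.span ℤ (insert h (range u)),
      (k • LinearMap.id : ℝ →ₗ[ℤ] ℝ) x ∈ Submodule.span ℤ (range u) := by
    intro x hx
    have : Submodule.span ℤ (insert h (range u)) ≤
        (Submodule.span ℤ (range u)).comap (k • LinearMap.id : ℝ →ₗ[ℤ] ℝ) := by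
      rw [Submodule.span_le, Set.insert_subset_iff]
      exact ⟨hkh, fun y hy => Submodule.smul_mem _ k (Submodule.subset_span hy)⟩
    exact this hx
  have : Module.Finite ℤ (Submodule.span ℤ (range u)) :=
    Module.Finite.span_of_finite ℤ (finite_range u)
  have : Module.Finite ℤ (Submodule.span ℤ (insert h (range u))) :=
    Module.Finite.span_of_finite ℤ ((finite_range u).insert h)
  rw [← finrank_span_eq_card hu]
  refine le_antisymm (LinearMap.finrank_le_finrank_of_injective
    (f := (k • LinearMap.id : ℝ →ₗ[ℤ] ℝ).restrict hmem) fun x y hxy => ?_)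
    (Submodule.finrank_mono (Submodule.span_mono (subset_insert _ _)))
  have h1 := congrArg Subtype.val hxy
  exact Subtype.ext (smul_right_injective ℝ hk h1)

/-- Adjoining an element that is commensurable with the group changes only finitely many members of
a suitable basis. -/
theorem exists_basis_closure_union_singleton {ι : Type*} {H : AddSubgroup ℝ}
    (b : Module.Basis ι ℤ H) {h : ℝ} {k : ℤ} (hk : k ≠ 0) (hkh : k • h ∈ H) :
    ∃ b' : Module.Basis ι ℤ (AddSubgroup.closure ((H : Set ℝ) ∪ {h})),
      {j | (b' j : ℝ) ≠ b j}.Finite := by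
  classical
  set v : ι → ℝ := fun j => b j with hvdef
  have hv : LinearIndependent ℤ v :=
    b.linearIndependent.map' H.subtype.toIntLinearMap
      (LinearMap.ker_eq_bot.mpr H.subtype_injective)
  have hrepr : ∀ x : H, (x : ℝ) = (b.repr x).sum fun j a => a • v j := by
    intro x
    have h1 := congrArg (fun z : H => (z : ℝ)) (b.linearCombination_repr x)
    simpa [Finsupp.linearCombination_apply, Finsupp.sum] using h1.symm
  -- Only the basis members occurring in `k • h` need to change. They and `h` span a finitely
  -- generated torsion-free group of rank `|S|`, whose basis can again be indexed by `S`.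
  set S : Finset ι := (b.repr ⟨k • h, hkh⟩).support with hS
  set u : S → ℝ := fun s => v s with hudef
  have hu : LinearIndependent ℤ u := hv.comp _ Subtype.val_injective
  have hrangeu : range u = v '' S := by
    ext x
    simp [hudef]
  have hku : k • h ∈ Submodule.span ℤ (range u) := by
    have h1 := hrepr ⟨k • h, hkh⟩
    simp only at h1
    rw [h1]
    exact Submodule.sum_mem _ fun j hj =>
      Submodule.smul_mem _ _ (Submodule.subset_span ⟨⟨j, hj⟩, rfl⟩)
  set G := Submodule.span ℤ (insert h (range u)) with hG
  have : Module.Finite ℤ G := Module.Finite.span_of_finite ℤ ((finite_range u).insert h)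
  let g : Module.Basis S ℤ G :=
    Module.Basis.reindex (Module.finBasisOfFinrankEq ℤ G (finrank_span_insert_eq_card hu hk hku))
      (Fintype.equivFin S).symm
  have hgspan : Submodule.span ℤ (range fun s => (g s : ℝ)) = G := by
    have h1 := congrArg (Submodule.map G.subtype) g.span_eq
    rw [Submodule.map_span, ← range_comp, Submodule.map_top, Submodule.range_subtype] at h1
    exact h1
  have hgind : LinearIndependent ℤ fun s => (g s : ℝ) :=
    g.linearIndependent.map' G.subtype (Submodule.ker_subtype G)
  let w : ι → ℝ := fun j => if hj : j ∈ S then g ⟨j, hj⟩ else v j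
  have hwS : ∀ s : S, w s = g s := fun s => by simp [w]
  have hwS' : ∀ j ∉ S, w j = v j := fun j hj => by simp [w, hj]
  -- The new block stays independent of the untouched members: `k` times a common element lies in
  -- the spans of two complementary parts of `v`, hence vanishes.
  have hdisj : Disjoint G (Submodule.span ℤ (range fun j : {j // j ∉ S} => v j)) := by
    rw [Submodule.disjoint_def]
    intro x hx hx'
    have hd := hv.disjoint_span_image (disjoint_compl_right (a := (S : Set ι)))
    rw [← hrangeu, Submodule.disjoint_def] at hd
    have h1 : k • x ∈ Submodule.span ℤ (range u) := by
      have : G ≤ (Submodule.span ℤ (range u)).comap (k • LinearMap.id : ℝ →ₗ[ℤ] ℝ) := by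
        rw [hG, Submodule.span_le, Set.insert_subset_iff]
        exact ⟨hku, fun y hy => Submodule.smul_mem _ k (Submodule.subset_span hy)⟩
      exact this hx
    have h2 : k • x ∈ Submodule.span ℤ (v '' (S : Set ι)ᶜ) := by
      refine Submodule.smul_mem _ k (Submodule.span_mono ?_ hx')
      rintro _ ⟨j, rfl⟩
      exact ⟨j, by simp, rfl⟩
    exact (smul_eq_zero.mp (hd _ h1 h2)).resolve_left hk
  have hwind : LinearIndependent ℤ w := by
    rw [← linearIndependent_equiv (Equiv.sumCompl (· ∈ S))]
    have h1 := hgind.sum_type (v' := fun j : {j // j ∉ S} => v j)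
      (hv.comp _ Subtype.val_injective) (by rwa [hgspan])
    have h2 : w ∘ Equiv.sumCompl (· ∈ S) =
        Sum.elim (fun s => (g s : ℝ)) fun j : {j // j ∉ S} => v j := by
      funext j
      rcases j with j | j
      · exact hwS j
      · exact hwS' j j.2
    rw [h2]
    exact h1
  have hclosure : ∀ x : ℝ, x ∈ AddSubgroup.closure (range w) ↔ x ∈ Submodule.span ℤ (range w) := by
    intro x
    rw [← Submodule.span_int_eq_addSubgroupClosure]
    rfl
  have hGw : G ≤ Submodule.span ℤ (range w) := by
    rw [← hgspan]
    refine Submodule.span_mono ?_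
    rintro _ ⟨s, rfl⟩
    exact ⟨s, hwS s⟩
  have hwC : AddSubgroup.closure (range w) = AddSubgroup.closure ((H : Set ℝ) ∪ {h}) := by
    refine le_antisymm ((AddSubgroup.closure_le _).mpr ?_) ((AddSubgroup.closure_le _).mpr ?_)
    · rintro _ ⟨j, rfl⟩
      by_cases hj : j ∈ S
      · have h1 : G ≤ (AddSubgroup.closure ((H : Set ℝ) ∪ {h})).toIntSubmodule := by
          rw [hG, Submodule.span_le, Set.insert_subset_iff]
          refine ⟨AddSubgroup.subset_closure (Or.inr rfl), ?_⟩
          rintro _ ⟨s, rfl⟩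
          exact AddSubgroup.subset_closure (Or.inl (b s).2)
        rw [hwS ⟨j, hj⟩]
        exact h1 (g ⟨j, hj⟩).2
      · rw [hwS' j hj]
        exact AddSubgroup.subset_closure (Or.inl (b j).2)
    · rintro x (hx | rfl)
      · rw [SetLike.mem_coe, hclosure, show x = _ from hrepr ⟨x, hx⟩]
        refine Submodule.sum_mem _ fun j _ => Submodule.smul_mem _ _ ?_
        by_cases hj : j ∈ S
        · exact hGw (Submodule.subset_span (Or.inr ⟨⟨j, hj⟩, rfl⟩))
        · exact Submodule.subset_span ⟨j, hwS' j hj⟩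
      · rw [SetLike.mem_coe, hclosure]
        exact hGw (Submodule.subset_span (Or.inl rfl))
  obtain ⟨b', hb'⟩ := exists_basis_of_closure_range_eq hwind hwC
  refine ⟨b', S.finite_toSet.subset fun j hj => ?_⟩
  by_contra hjS
  exact hj ((hb' j).trans (hwS' j hjS))

theorem exists_zsmul_mem_closure_of_mem_span_rat {s : Set ℝ} {x : ℝ}
    (hx : x ∈ Submodule.span ℚ s) : ∃ k : ℤ, k ≠ 0 ∧ k • x ∈ AddSubgroup.closure s := by
  induction hx using Submodule.span_induction with
  | mem x hx => exact ⟨1, one_ne_zero, by simpa using AddSubgroup.subset_closure hx⟩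
  | zero => exact ⟨1, one_ne_zero, by simp⟩
  | add x y _ _ hx hy =>
    obtain ⟨k, hk, hkx⟩ := hx
    obtain ⟨l, hl, hly⟩ := hy
    refine ⟨k * l, mul_ne_zero hk hl, ?_⟩
    rw [smul_add]
    refine add_mem ?_ ?_
    · rw [mul_comm, mul_smul]
      exact zsmul_mem hkx l
    · rw [mul_smul]
      exact zsmul_mem hly k
  | smul q x _ hx =>
    obtain ⟨k, hk, hkx⟩ := hx
    refine ⟨k * q.den, mul_ne_zero hk (by exact_mod_cast q.den_ne_zero), ?_⟩
    have h1 : (k * q.den : ℤ) • q • x = q.num • k • x := by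
      have h2 : (q.den : ℝ) * q = q.num := by exact_mod_cast Rat.den_mul_eq_num q
      rw [Rat.smul_def, zsmul_eq_mul, zsmul_eq_mul, zsmul_eq_mul, ← h2]
      push_cast
      ring
    rw [h1]
    exact zsmul_mem hkx _

theorem IsMaximalIndependent.exists_zsmul_mem {ι : Type*} {H : AddSubgroup ℝ} {ω : ι → ℝ}
    (hω : IsMaximalIndependent H ω) {x : ℝ} (hx : x ∈ H) :
    ∃ k : ℤ, k ≠ 0 ∧ k • x ∈ AddSubgroup.closure (range ω) := by
  refine exists_zsmul_mem_closure_of_mem_span_rat (by_contra fun hspan => ?_)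
  have hxω : x ∉ range ω := fun h => hspan (Submodule.subset_span h)
  -- Independence over ℤ and over ℚ agree. Over the field ℚ, a vector outside the span can be
  -- adjoined, contradicting maximality.
  have hind : LinearIndepOn ℚ id (insert x (range ω)) := by
    rw [linearIndepOn_id_insert hxω]
    refine ⟨LinearIndependent.linearIndepOn_id ?_, hspan⟩
    exact (LinearIndependent.iff_fractionRing ℤ ℚ).mp hω.indep
  refine hxω ?_
  rw [← hω.maximal (insert x (range ω)) (subset_insert _ _) ?_ ?_]
  · exact mem_insert _ _
  · rw [Set.insert_subset_iff]
    refine ⟨hx, ?_⟩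
    rintro _ ⟨j, rfl⟩
    exact hω.mem j
  · exact (LinearIndependent.iff_fractionRing ℤ ℚ).mpr hind

theorem bSeq_le {ι : Type*} {ω : ι → ℝ} {h : ℕ → ℝ} {H : AddSubgroup ℝ} (hω : ∀ j, ω j ∈ H)
    (hh : ∀ n, h n ∈ H) (n : ℕ) : bSeq ω h n ≤ H := by
  induction n with
  | zero =>
    refine (AddSubgroup.closure_le _).mpr ?_
    rintro _ ⟨j, rfl⟩
    exact hω j
  | succ n ih =>
    refine (AddSubgroup.closure_le _).mpr ?_
    rintro x (hx | rfl)
    · exact ih hx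
    · exact hh _

theorem IsMaximalIndependent.nonempty_bSeqBases {ι : Type*} {H : AddSubgroup ℝ} {ω : ι → ℝ}
    (hω : IsMaximalIndependent H ω) {h : ℕ → ℝ} (hh : ∀ n, h n ∈ H) :
    Nonempty (BSeqBases ω h) := by
  have hle : ∀ n, AddSubgroup.closure (range ω) ≤ bSeq ω h n := by
    intro n
    induction n with
    | zero => exact le_rfl
    | succ n ih => exact ih.trans (bSeq_le_succ ω h n)
  have hstep : ∀ n (b : Module.Basis ι ℤ (bSeq ω h n)),
      ∃ b' : Module.Basis ι ℤ (bSeq ω h (n + 1)), {j | (b' j : ℝ) ≠ b j}.Finite := by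
    intro n b
    obtain ⟨k, hk, hkh⟩ := hω.exists_zsmul_mem (hh (n + 1))
    exact exists_basis_closure_union_singleton b hk (hle n hkh)
  obtain ⟨b₀, hb₀⟩ := exists_basis_of_closure_range_eq hω.indep rfl
  choose next hnext using hstep
  exact ⟨⟨fun n => Nat.rec b₀ next n, hb₀, fun n => hnext n _⟩⟩

/-! ### Density and surjectivity in solenoids -/

namespace SolenoidMatrices

variable {ι : Type*} (M : SolenoidMatrices ι)

theorem coe_proj_smul_apply (ω : ι → ℝ) (t : ℝ) (n : ℕ) (r : ι) :
    (M.proj (t • ω) : ℕ → ι → UnitAddCircle) n r = circleProj (t * M.realLift ω n r) := by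
  simp [proj, realLift_smul]

/-- A coordinate of a point of a solenoid is determined by finitely many coordinates at any later
level. -/
theorem exists_finset_coord_eq (n k : ℕ) (r : ι) :
    ∃ S : Finset ι, ∀ y ∈ M.solenoid, ∀ z ∈ M.solenoid,
      (∀ s ∈ S, y (n + k) s = z (n + k) s) → y n r = z n r := by
  classical
  induction k with
  | zero => exact ⟨{r}, fun y _ z _ h => h r (Finset.mem_singleton_self r)⟩
  | succ k ih =>
    obtain ⟨S, hS⟩ := ih
    refine ⟨S.biUnion fun s => (M.mat (n + k) s).support, fun y hy z hz h => ?_⟩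
    refine hS y hy z hz fun s hs => ?_
    rw [← hy (n + k), ← hz (n + k)]
    refine Finset.sum_congr rfl fun q hq => ?_
    exact congrArg _ (h q (Finset.mem_biUnion.mpr ⟨s, hs, hq⟩))

/-- A finite set of coordinates, spread over several levels, is controlled by one finite torus at
the highest of these levels, where Kronecker's theorem applies. -/
theorem exists_finset_forall_coord_eq (E : Finset (ℕ × ι)) :
    ∃ (m : ℕ) (S : Finset ι), ∀ y ∈ M.solenoid, ∀ z ∈ M.solenoid,
      (∀ s ∈ S, y m s = z m s) → ∀ p ∈ E, y p.1 p.2 = z p.1 p.2 := by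
  classical
  choose S hS using M.exists_finset_coord_eq
  set m := E.sup Prod.fst with hm
  refine ⟨m, E.biUnion fun p => S p.1 (m - p.1) p.2, fun y hy z hz h p hp => ?_⟩
  have hpm : p.1 + (m - p.1) = m := Nat.add_sub_of_le (Finset.le_sup (f := Prod.fst) hp)
  refine hS p.1 (m - p.1) p.2 y hy z hz fun s hs => ?_
  rw [hpm]
  exact h s (Finset.mem_biUnion.mpr ⟨p, hp, hs⟩)

/-- On finitely many coordinates of one level the image is compact and, by Kronecker's theorem,
dense, hence everything. Matching ever larger finite sets of coordinates gives a net in the compact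
image that converges to the given point. -/
theorem surjective_of_linearIndependent {K : Type*} [TopologicalSpace K] [CompactSpace K]
    {ω : ι → ℝ} (hω : ∀ n, LinearIndependent ℤ (M.realLift ω n)) {g : K → M.solenoid}
    (hg : Continuous g) (horbit : ∀ t : ℝ, M.proj (t • ω) ∈ range g) :
    Function.Surjective g := by
  classical
  have hfin : ∀ (m : ℕ) (S : Finset ι) (y : M.solenoid), ∃ k, ∀ s ∈ S,
      (g k : ℕ → ι → UnitAddCircle) m s = (y : ℕ → ι → UnitAddCircle) m s := by
    intro m S y
    let p : K → S → UnitAddCircle := fun k s => (g k : ℕ → ι → UnitAddCircle) m s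
    have hp : Continuous p := continuous_pi fun s =>
      (continuous_apply (s : ι)).comp ((continuous_apply m).comp (continuous_subtype_val.comp hg))
    have hdense : DenseRange p := by
      have h1 := denseRange_circleProj_mul ((hω m).comp ((↑) : S → ι) Subtype.val_injective)
      refine h1.mono ?_
      rintro _ ⟨t, rfl⟩
      obtain ⟨k, hk⟩ := horbit t
      refine ⟨k, ?_⟩
      funext s
      simp only [p, hk, coe_proj_smul_apply, Function.comp_apply]
    have hrange : range p = univ := by
      rw [← (isCompact_range hp).isClosed.closure_eq, hdense.closure_range]
    obtain ⟨k, hk⟩ : (fun s : S => (y : ℕ → ι → UnitAddCircle) m s) ∈ range p := by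
      rw [hrange]
      trivial
    exact ⟨k, fun s hs => congrFun hk ⟨s, hs⟩⟩
  intro y
  have hagree : ∀ E : Finset (ℕ × ι), ∃ k, ∀ p ∈ E,
      (g k : ℕ → ι → UnitAddCircle) p.1 p.2 = (y : ℕ → ι → UnitAddCircle) p.1 p.2 := by
    intro E
    obtain ⟨m, S, hS⟩ := M.exists_finset_forall_coord_eq E
    obtain ⟨k, hk⟩ := hfin m S y
    exact ⟨k, hS _ (g k).2 _ y.2 hk⟩
  choose k hk using hagree
  -- The net is indexed by finite sets of coordinates; each coordinate is eventually constant along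
  -- it.
  have hlim : Tendsto (fun E => g (k E)) atTop (𝓝 y) := by
    rw [tendsto_subtype_rng, tendsto_pi_nhds]
    refine fun n => tendsto_pi_nhds.mpr fun r => tendsto_const_nhds.congr' ?_
    filter_upwards [eventually_ge_atTop {(n, r)}] with E hE
    exact (hk E (n, r) (Finset.singleton_subset_iff.mp hE)).symm
  exact (isCompact_range hg).isClosed.mem_of_tendsto hlim (Eventually.of_forall fun E => ⟨k E, rfl⟩)

/-- Orbits are translates of one another in a topological group, so they have the same convergent
time sequences. -/
theorem expGroup_linearFlow (ω : ι → ℝ) (z : M.solenoid) :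
    expGroup (fun t => M.linearFlow ω t z) = expGroup fun t => M.proj (t • ω) := by
  have hiff : ∀ t, IsExpSequence (fun t => M.linearFlow ω t z) t ↔
      IsExpSequence (fun t => M.proj (t • ω)) t := by
    refine fun t => ⟨fun ⟨y, hy⟩ => ⟨y + -z, ?_⟩, fun ⟨y, hy⟩ => ⟨y + z, hy.add_const z⟩⟩
    refine (hy.add_const (-z)).congr fun i => ?_
    exact add_neg_cancel_right (M.proj (t i • ω)) z
  ext α
  exact forall_congr' fun t => imp_congr_left (hiff t)

end SolenoidMatrices

/-! ### Frequencies and exponents of the dual -/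

namespace BSeqBases

variable {ι : Type*} {ω : ι → ℝ} {h : ℕ → ℝ} (b : BSeqBases ω h)

/-- By construction the matrix of level `n` sends the vector bⁿ⁺¹ to bⁿ, and on real vectors it is
injective. -/
theorem realLift_dual (n : ℕ) : b.dual.realLift ω n = fun r => (b.basis n r : ℝ) := by
  induction n with
  | zero => exact funext fun j => (b.basis_zero j).symm
  | succ n ih =>
    apply (b.dual.block n).bijective.1
    rw [SolenoidMatrices.rowAct_realLift, ih]
    exact funext fun r => (b.coord_sum n r).symm

theorem linearIndependent_realLift_dual (n : ℕ) :
    LinearIndependent ℤ (b.dual.realLift ω n) := by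
  rw [realLift_dual]
  exact (b.basis n).linearIndependent.map' (bSeq ω h n).subtype.toIntLinearMap
    (LinearMap.ker_eq_bot.mpr (bSeq ω h n).subtype_injective)

theorem mem_expGroup_proj_dual {α : ℝ} {n : ℕ} (hα : α ∈ bSeq ω h n) :
    α ∈ expGroup fun t => b.dual.proj (t • ω) := by
  have hbasis : ∀ r, (b.basis n r : ℝ) ∈ expGroup fun t => b.dual.proj (t • ω) := by
    rintro r t ⟨y, hy⟩
    have h1 := tendsto_pi_nhds.mp (tendsto_pi_nhds.mp (tendsto_subtype_rng.mp hy) n) r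
    refine ⟨_, h1.congr fun i => ?_⟩
    rw [SolenoidMatrices.coe_proj_smul_apply, realLift_dual, mul_comm]
  have hrepr := congrArg (fun z : bSeq ω h n => (z : ℝ))
    ((b.basis n).linearCombination_repr ⟨α, hα⟩)
  simp only [Finsupp.linearCombination_apply, Finsupp.sum, AddSubgroup.val_finsetSum,
    AddSubgroup.coe_zsmul] at hrepr
  rw [← hrepr]
  exact sum_mem fun r _ => zsmul_mem (hbasis r) _

end BSeqBases

/-! ### Semiconjugacies and the main theorem -/

theorem expGroup_proj_le_of_isSemiconjugacy {X : Type*} [TopologicalSpace X] {φ : Flow ℝ X}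
    {x : X} {ι : Type*} {N : SolenoidMatrices ι} {ω : ι → ℝ}
    {g : closure (φ.orbit x) → N.solenoid}
    (hg : Flow.IsSemiconjugacy g (orbitClosureFlow φ x) (N.linearFlow ω)) :
    (expGroup fun t => N.proj (t • ω)) ≤ expGroup fun t => φ t x := by
  -- `g` need not send `x` to the identity, so the exponents are computed along the orbit of the
  -- image of `x`.
  rw [← N.expGroup_linearFlow ω (g (orbitPoint φ x 0))]
  rintro α hα t ⟨y, hy⟩
  have hyK : y ∈ closure (φ.orbit x) :=
    mem_closure_of_tendsto hy (Eventually.of_forall fun i => φ.mem_orbit x (t i))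
  have hlim : Tendsto (fun i => orbitPoint φ x (t i)) atTop (𝓝 ⟨y, hyK⟩) :=
    tendsto_subtype_rng.mpr hy
  refine hα t ⟨g ⟨y, hyK⟩, ((hg.cont.tendsto _).comp hlim).congr fun i => ?_⟩
  have h1 : orbitPoint φ x (t i) = orbitClosureFlow φ x (t i) (orbitPoint φ x 0) := by
    refine Subtype.ext ?_
    change φ (t i) x = φ (t i) (φ 0 x)
    rw [φ.map_zero_apply]
  rw [Function.comp_apply, h1]
  exact hg.semiconj (t i) _

theorem exists_isSemiconjugacy_dual {X : Type*} [MetricSpace X] (φ : Flow ℝ X) (x : X)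
    (hcompact : IsCompact (closure (φ.orbit x))) {ι : Type*} {ω : ι → ℝ} {h : ℕ → ℝ}
    (hH : ∀ n, bSeq ω h n ≤ expGroup fun t => φ t x) (b : BSeqBases ω h) :
    ∃ hf : closure (φ.orbit x) → b.dual.solenoid,
      Flow.IsSemiconjugacy hf (orbitClosureFlow φ x) (b.dual.linearFlow ω) := by
  have : CompactSpace (closure (φ.orbit x)) := isCompact_iff_compactSpace.mp hcompact
  choose χ hχ using fun n r => exists_character_of_mem_expGroup φ x (hH n (b.basis n r).2)
  have hproj : ∀ t n r, χ n r (orbitPoint φ x t) =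
      (b.dual.proj (t • ω) : ℕ → ι → UnitAddCircle) n r := by
    intro t n r
    rw [hχ, SolenoidMatrices.coe_proj_smul_apply, b.realLift_dual, mul_comm]
  have hmem : ∀ y, (fun n r => χ n r y) ∈ b.dual.solenoid := by
    -- Both sides of the bonding relation are continuous on the orbit closure and agree on the
    -- orbit.
    intro y n
    funext r
    have hcont : Continuous fun y => rowAct (b.dual.mat n) (fun r => χ (n + 1) r y) r := by
      unfold rowAct Finsupp.sum
      fun_prop
    refine congrFun ((denseRange_orbitPoint φ x).equalizer hcont (χ n r).continuous ?_) y
    funext t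
    have h1 := congrFun ((b.dual.proj (t • ω)).2 n) r
    simp only [Function.comp_apply, hproj]
    exact h1
  let hf : closure (φ.orbit x) → b.dual.solenoid := fun y => ⟨fun n r => χ n r y, hmem y⟩
  have hcont : Continuous hf := Continuous.subtype_mk
    (continuous_pi fun n => continuous_pi fun r => (χ n r).continuous) _
  have horbit : ∀ t, hf (orbitPoint φ x t) = b.dual.proj (t • ω) := fun t =>
    Subtype.ext (funext fun n => funext fun r => hproj t n r)
  refine ⟨hf, hcont, b.dual.surjective_of_linearIndependent b.linearIndependent_realLift_dual
    hcont fun t => ⟨_, horbit t⟩, fun t y => ?_⟩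
  refine congrFun ((denseRange_orbitPoint φ x).equalizer
    (hcont.comp ((orbitClosureFlow φ x).continuous_toFun t))
    (((b.dual.linearFlow ω).continuous_toFun t).comp hcont) ?_) y
  funext s
  have h1 : orbitClosureFlow φ x t (orbitPoint φ x s) = orbitPoint φ x (t + s) :=
    Subtype.ext (φ.map_add t s x).symm
  change hf (orbitClosureFlow φ x t (orbitPoint φ x s)) =
    b.dual.proj (t • ω) + hf (orbitPoint φ x s)
  rw [h1, horbit, horbit, add_smul, SolenoidMatrices.proj_add]

theorem mainTheorem5 {X : Type*} [MetricSpace X] (φ : Flow ℝ X) (x : X)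
    (hcompact : IsCompact (closure (φ.orbit x))) :
    (expGroup fun t => φ t x : Set ℝ).Countable ∧
    ∀ {ι : Type*} (ω : ι → ℝ) (h : ℕ → ℝ),
      IsMaximalIndependent (expGroup fun t => φ t x) ω →
      h 0 = 0 → Set.range h = (expGroup fun t => φ t x : Set ℝ) →
      Nonempty (BSeqBases ω h) ∧
      ∀ b : BSeqBases ω h,
        (∃ hf : closure (φ.orbit x) → b.dual.solenoid,
          Flow.IsSemiconjugacy hf (orbitClosureFlow φ x) (b.dual.linearFlow ω)) ∧
        (∀ z : b.dual.solenoid,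
          expGroup (fun t => b.dual.linearFlow ω t z) = expGroup fun t => φ t x) ∧
        ∀ {ι' : Type*} (N : SolenoidMatrices ι') (ω' : ι' → ℝ)
          (g : closure (φ.orbit x) → N.solenoid),
          Flow.IsSemiconjugacy g (orbitClosureFlow φ x) (N.linearFlow ω') →
          ∀ (z : b.dual.solenoid) (z' : N.solenoid),
            expGroup (fun t => N.linearFlow ω' t z') ≤
              expGroup (fun t => b.dual.linearFlow ω t z) := by

  refine ⟨countable_expGroup φ x hcompact, fun {ι} ω h hω h0 hrange => ?_⟩
  have hh : ∀ n, h n ∈ expGroup fun t => φ t x := fun n =>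
    (Set.ext_iff.mp hrange (h n)).mp (mem_range_self n)
  refine ⟨hω.nonempty_bSeqBases hh, fun b => ?_⟩
  have hsemi := exists_isSemiconjugacy_dual φ x hcompact (bSeq_le hω.mem hh) b
  have heq : ∀ z : b.dual.solenoid,
      expGroup (fun t => b.dual.linearFlow ω t z) = expGroup fun t => φ t x := by
    intro z
    rw [b.dual.expGroup_linearFlow]
    obtain ⟨hf, hhf⟩ := hsemi
    refine le_antisymm (expGroup_proj_le_of_isSemiconjugacy hhf) fun α hα => ?_
    obtain ⟨n, rfl⟩ : α ∈ range h := by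
      rw [hrange]
      exact hα
    -- The `B`-sequence never adjoins `h 0`, so the index 0 relies on `h 0 = 0`; every later `h (n +
    -- 1)` is adjoined at stage `n + 1`.
    rcases n with _ | n
    · exact b.mem_expGroup_proj_dual (n := 0) (h0 ▸ zero_mem _)
    · exact b.mem_expGroup_proj_dual (n := n + 1) (AddSubgroup.subset_closure (Or.inr rfl))
  refine ⟨hsemi, heq, fun N ω' g hg z z' => ?_⟩
  rw [heq, N.expGroup_linearFlow]
  exact expGroup_proj_le_of_isSemiconjugacy hg
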